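/- Let $d\ge 1$ and $N$ be natural numbers. A (deterministic) port-based teleportation protocol with input dimension $d$ and $N$ ports consists of a finite-dimensional Hilbert space $\mathcal H_A$ of Alice, a resource state $\rho_{AB_1\cdots B_N}$ (pure or mixed) on $\mathcal H_A\otimes(\mathbb C^d)^{\otimes N}$, where Bob holds the ports $B_1,\dots,B_N\cong\mathbb C^d$, and a POVM $\{E_i\}_{i=1}^N$ on $\mathcal H_{A_0}\otimes\mathcal H_A$, where $A_0\cong\mathbb C^d$ is Alice's input register. Alice measures the POVM and sends the outcome $i$ to Bob, who keeps the port $B_i$ as the output register $B_0$ and discards the other ports; the protocol thus implements the channel $$\Lambda(X)=\sum_{i=1}^N \mathrm{id}_{B_i\to B_0}\,\mathrm{tr}_{A_0AB_i^c}\bigl[(E_i\otimes I_{B_1\cdots B_N})(X_{A_0}\otimes\rho_{AB_1\cdots B_N})\bigr],$$ where $B_i^c$ denotes all ports except $B_i$. Its entanglement fidelity is $$F(\Lambda)=F\bigl((\mathrm{id}\otimes\Lambda)(\phi^+),\phi^+\bigr),\qquad \phi^+=|\phi^+\rangle\langle\phi^+|,\quad |\phi^+\rangle=\tfrac1{\sqrt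 d}\sum_{i=1}^d|i\rangle\otimes|i\rangle,$$ with $F(\rho,\sigma)=\|\sqrt\rho\sqrt\sigma\|_1^2$. Let $F_d^*(N)$ be the supremum of the entanglement fidelity over all such protocols. Then every port-based teleportation protocol with input dimension $d$ and $N$ ports has entanglement fidelity at most $\sqrt N/d$, and hence $$F_d^*(N)\le\frac{\sqrt N}{d}.$$ (For $N=0$ there is no protocol, and $F_d^*(0)$ is read as $0$.) -/

import Mathlib

open scoped Matrix Kronecker ComplexOrder MatrixOrder

noncomputable section

namespace PBT

/-- A quantum state on the Hilbert space `ℂ^ι`: a positive semidefinite operator of unit trace. -/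
structure IsState {ι : Type*} [Fintype ι] (ρ : Matrix ι ι ℂ) : Prop where
  posSemidef : ρ.PosSemidef
  trace_eq_one : ρ.trace = 1

/-- A POVM with outcomes in `O` on the Hilbert space `ℂ^ι`. -/
structure IsPOVM {ι O : Type*} [Fintype ι] [DecidableEq ι] [Fintype O]
    (E : O → Matrix ι ι ℂ) : Prop where
  posSemidef : ∀ o, (E o).PosSemidef
  sum_eq_one : ∑ o, E o = 1

/-- The trace norm `‖X‖₁ = tr √(X† X)`. -/
def traceNorm {ι : Type*} [Fintype ι] [DecidableEq ι] (X : Matrix ι ι ℂ) : ℝ :=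
  (CFC.sqrt (Xᴴ * X)).trace.re

/-- The fidelity `F(ρ, σ) = ‖√ρ √σ‖₁²`. -/
def fidelity {ι : Type*} [Fintype ι] [DecidableEq ι] (ρ σ : Matrix ι ι ℂ) : ℝ :=
  traceNorm (CFC.sqrt ρ * CFC.sqrt σ) ^ 2

/-- The unit vector `|φ⁺⟩ = d^{-1/2} ∑ᵢ |i⟩ ⊗ |i⟩` in `ℂ^d ⊗ ℂ^d`. -/
def maxEntangledVec (d : ℕ) : Fin d × Fin d → ℂ :=
  fun p => if p.1 = p.2 then ((Real.sqrt d : ℝ) : ℂ)⁻¹ else 0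

/-- The maximally entangled state `φ⁺ = |φ⁺⟩⟨φ⁺|`. -/
def maxEntangled (d : ℕ) : Matrix (Fin d × Fin d) (Fin d × Fin d) ℂ :=
  Matrix.vecMulVec (maxEntangledVec d) (star (maxEntangledVec d))

/-- The map `id_R ⊗ Λ`, for a linear map `Λ` on operators: `Λ` is applied to every block
`⟨r| M |r'⟩` of `M = ∑ |r⟩⟨r'| ⊗ ⟨r| M |r'⟩`. -/
def idTensor {ι κ : Type*} (R : Type*) (Λ : Matrix ι ι ℂ →ₗ[ℂ] Matrix κ κ ℂ)
    (M : Matrix (R × ι) (R × ι) ℂ) : Matrix (R × κ) (R × κ) ℂ :=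
  Matrix.of fun p q => Λ (Matrix.of fun i j => M (p.1, i) (q.1, j)) p.2 q.2

/-- The entanglement fidelity
`F(Λ₁, Λ₂) = F((id ⊗ Λ₁)(φ⁺), (id ⊗ Λ₂)(φ⁺))` of two maps on `B(ℂ^d)`. -/
def channelFidelity {d : ℕ}
    (Λ₁ Λ₂ : Matrix (Fin d) (Fin d) ℂ →ₗ[ℂ] Matrix (Fin d) (Fin d) ℂ) : ℝ :=
  fidelity (idTensor (Fin d) Λ₁ (maxEntangled d)) (idTensor (Fin d) Λ₂ (maxEntangled d))

/-- The partial trace over the first tensor factor. -/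
def partialTraceLeft {ι κ : Type*} [Fintype ι] :
    Matrix (ι × κ) (ι × κ) ℂ →ₗ[ℂ] Matrix κ κ ℂ where
  toFun M := Matrix.of fun b b' => ∑ a, M (a, b) (a, b')
  map_add' M M' := by
    ext b b'
    simp [Finset.sum_add_distrib]
  map_smul' c M := by
    ext b b'
    simp [Finset.mul_sum]

/-- The Hilbert space of Bob's `N` ports `B₁ ⋯ B_N` is `(ℂ^d)^{⊗ N}`, with the product basis
indexed by `Ports d N`. -/
abbrev Ports (d N : ℕ) : Type := Fin N → Fin d

/-- The partial trace over all ports but the `i`-th one, followed by the renaming of the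
`i`-th port to Bob's output register `B₀ ≅ ℂ^d`. -/
def selectPort {d N : ℕ} (i : Fin N) :
    Matrix (Ports d N) (Ports d N) ℂ →ₗ[ℂ] Matrix (Fin d) (Fin d) ℂ where
  toFun M := Matrix.of fun b b' => ∑ c : {j : Fin N // j ≠ i} → Fin d,
    M ((Equiv.funSplitAt i (Fin d)).symm (b, c)) ((Equiv.funSplitAt i (Fin d)).symm (b', c))
  map_add' M M' := by
    ext b b'
    simp [Finset.sum_add_distrib]
  map_smul' c M := by
    ext b b'
    simp [Finset.mul_sum]

/-- A (deterministic) port-based teleportation protocol with input dimension `d` and `N` ports.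
Alice's share of the resource is the Hilbert space `ℂ^α` (for instance `(ℂ^d)^{⊗ N}`, with
`α = Ports d N`), Bob's share is `(ℂ^d)^{⊗ N}`, and the resource state is an arbitrary, pure or
mixed, state of the joint system.  Alice's measurement is a POVM with outcomes `1, …, N` on her
input register `A₀ ≅ ℂ^d` together with her share of the resource. -/
structure Protocol (d N : ℕ) (α : Type*) [Fintype α] [DecidableEq α] where
  resource : Matrix (α × Ports d N) (α × Ports d N) ℂ
  isState : IsState resource
  povm : Fin N → Matrix (Fin d × α) (Fin d × α) ℂ
  isPOVM : IsPOVM povm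

namespace Protocol

variable {d N : ℕ} {α : Type*} [Fintype α] [DecidableEq α]

/-- The unnormalised joint operator `(E_i ⊗ 1_B) (X ⊗ ρ)` on `(A₀ A) B`. -/
def branch (P : Protocol d N α) (i : Fin N) :
    Matrix (Fin d) (Fin d) ℂ →ₗ[ℂ]
      Matrix ((Fin d × α) × Ports d N) ((Fin d × α) × Ports d N) ℂ where
  toFun X := (P.povm i ⊗ₖ (1 : Matrix (Ports d N) (Ports d N) ℂ)) *
    (X ⊗ₖ P.resource).reindex (Equiv.prodAssoc _ _ _).symm (Equiv.prodAssoc _ _ _).symm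
  map_add' X Y := by
    rw [Matrix.add_kronecker, ← Matrix.mul_add]
    rfl
  map_smul' c X := by
    rw [Matrix.smul_kronecker, RingHom.id_apply, ← Matrix.mul_smul]
    rfl

/-- The channel from Alice's input `A₀` to Bob's output `B₀` that the protocol implements:
`Λ(X) = ∑ᵢ tr_{A₀ A Bᵢᶜ} [(E_i ⊗ 1_B) (X ⊗ ρ)]`. -/
def channel (P : Protocol d N α) :
    Matrix (Fin d) (Fin d) ℂ →ₗ[ℂ] Matrix (Fin d) (Fin d) ℂ :=
  ∑ i : Fin N, selectPort i ∘ₗ partialTraceLeft ∘ₗ P.branch i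

/-- The entanglement fidelity `F(Λ, id)` of the channel `Λ` implemented by the protocol. -/
def entanglementFidelity (P : Protocol d N α) : ℝ :=
  channelFidelity P.channel LinearMap.id

end Protocol

/-- The optimal entanglement fidelity `F*_d(N)`: the supremum of the entanglement fidelity over
all protocols with input dimension `d` and `N` ports, i.e. over all finite-dimensional systems of
Alice, all resource states and all POVMs. -/
def optimalFidelity (d N : ℕ) : ℝ :=
  ⨆ p : Σ m : ℕ, Protocol d N (Fin m), p.2.entanglementFidelity

end PBT

end

/-! Write `σ = 1 ⊗ ρ` on input, Alice and ports, of trace `d`, and `W_i` for the swap of the input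
with port `i`. Since `∑ |r⟩⟨r'| ⊗ |r'⟩⟨r|` is the swap, the overlap of the Choi state with `φ⁺`
equals `d⁻² ∑ᵢ tr((E_i ⊗ 1) W_i σ)` (`sum_channel_eq_sum_trace`). Cauchy–Schwarz for the
Hilbert–Schmidt product, with `E_i ≤ 1` and `W_i` unitary, bounds each term by `√tr(E_i σ) · √tr σ`.
As the `tr(E_i σ)` add up to `tr σ`, a second Cauchy–Schwarz over the outcomes gives `√N · tr σ = √N
· d`, whence `√N / d`. -/

namespace PBT

/-! ### Cauchy–Schwarz bounds for effects and permuted positive operators. -/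

section TraceInequalities

variable {n : Type*} [Fintype n]

theorem norm_trace_conjTranspose_mul_le (A B : Matrix n n ℂ) :
    ‖(Aᴴ * B).trace‖ ≤ √(Aᴴ * A).trace.re * √(Bᴴ * B).trace.re := by
  have key (A B : Matrix n n ℂ) : (Aᴴ * B).trace =
      inner ℂ (WithLp.toLp 2 fun p : n × n => A p.2 p.1)
        (WithLp.toLp 2 fun p : n × n => B p.2 p.1) := by
    simp [Matrix.trace, Matrix.mul_apply, PiLp.inner_apply, Fintype.sum_prod_type, mul_comm]
  have h (A : Matrix n n ℂ) : √(Aᴴ * A).trace.re =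
      ‖(WithLp.toLp 2 fun p : n × n => A p.2 p.1 : EuclideanSpace ℂ (n × n))‖ := by
    rw [key, norm_eq_sqrt_re_inner (𝕜 := ℂ)]
    rfl
  rw [h, h, key]
  exact norm_inner_le_norm _ _

variable [DecidableEq n]

theorem posSemidef_eq_conjTranspose_mul_self {A : Matrix n n ℂ} (hA : A.PosSemidef) :
    ∃ B : Matrix n n ℂ, A = Bᴴ * B :=
  CStarAlgebra.nonneg_iff_eq_star_mul_self.1 hA.nonneg

theorem trace_conj_re_le {E : Matrix n n ℂ} (hE : (1 - E).PosSemidef) (B : Matrix n n ℂ) :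
    (Bᴴ * E * B).trace.re ≤ (Bᴴ * B).trace.re := by
  have h := (hE.conjTranspose_mul_mul_same B).trace_nonneg
  rw [Matrix.mul_sub, Matrix.sub_mul, Matrix.mul_one, Matrix.trace_sub] at h
  have := (Complex.le_def.1 h).1
  simp at this
  linarith

/-- Cauchy–Schwarz for an effect `E` and a positive operator `σ` whose rows are permuted. -/
theorem norm_trace_mul_submatrix_le {E σ : Matrix n n ℂ} (hE : E.PosSemidef)
    (hE' : (1 - E).PosSemidef) (hσ : σ.PosSemidef) (e : Equiv.Perm n) :
    ‖(E * σ.submatrix e id).trace‖ ≤ √(E * σ).trace.re * √σ.trace.re := by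
  obtain ⟨C, rfl⟩ := posSemidef_eq_conjTranspose_mul_self hE
  obtain ⟨D, rfl⟩ := posSemidef_eq_conjTranspose_mul_self hσ
  have h1 : (Cᴴ * C * (Dᴴ * D).submatrix e id).trace =
      ((C * Dᴴ)ᴴ * (C * Dᴴ.submatrix e id)).trace := by
    have : (Dᴴ * D).submatrix e id = Dᴴ.submatrix e id * D := by
      rw [Matrix.submatrix_mul Dᴴ D e id id Function.bijective_id, Matrix.submatrix_id_id]
    rw [this, ← Matrix.mul_assoc, Matrix.trace_mul_comm]
    simp [Matrix.mul_assoc]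
  have h2 : (Cᴴ * C * (Dᴴ * D)).trace = ((C * Dᴴ)ᴴ * (C * Dᴴ)).trace := by
    rw [← Matrix.mul_assoc, Matrix.trace_mul_comm]
    simp [Matrix.mul_assoc]
  have h3 : ((C * Dᴴ.submatrix e id)ᴴ * (C * Dᴴ.submatrix e id)).trace.re ≤
      (Dᴴ * D).trace.re := by
    -- The effect is dropped using `E ≤ 1`; what remains is the trace of `Dᴴ * D` with its diagonal
    -- permuted by `e`.
    have := trace_conj_re_le hE' (Dᴴ.submatrix e id)
    calc _ = ((Dᴴ.submatrix e id)ᴴ * (Cᴴ * C) * Dᴴ.submatrix e id).trace.re := by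
            rw [Matrix.conjTranspose_mul]; simp only [Matrix.mul_assoc]
      _ ≤ _ := this
      _ = _ := by
        rw [Matrix.trace_mul_comm, Matrix.conjTranspose_submatrix,
          ← Matrix.submatrix_mul Dᴴ Dᴴᴴ e id e Function.bijective_id,
          Matrix.conjTranspose_conjTranspose]
        exact congrArg Complex.re (Equiv.sum_comp e fun j => (Dᴴ * D) j j)
  rw [h1, h2]
  exact (norm_trace_conjTranspose_mul_le _ _).trans (by gcongr)

theorem IsPOVM.one_sub_posSemidef {O : Type*} [Fintype O] {E : O → Matrix n n ℂ}
    (hE : IsPOVM E) (o : O) : (1 - E o).PosSemidef := by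
  classical
  rw [← hE.sum_eq_one, ← Finset.add_sum_erase _ _ (Finset.mem_univ o), add_sub_cancel_left]
  exact Matrix.posSemidef_sum _ fun i _ => hE.posSemidef i

theorem IsPOVM.norm_sum_trace_mul_submatrix_le {O : Type*} [Fintype O] {E : O → Matrix n n ℂ}
    (hE : IsPOVM E) {σ : Matrix n n ℂ} (hσ : σ.PosSemidef) (e : O → Equiv.Perm n) :
    ‖∑ o, (E o * σ.submatrix (e o) id).trace‖ ≤ √(Fintype.card O) * σ.trace.re := by
  have hσ0 : 0 ≤ σ.trace.re := (Complex.le_def.1 hσ.trace_nonneg).1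
  have hsum : ∑ o, (E o * σ).trace.re = σ.trace.re := by
    rw [← Complex.re_sum, ← Matrix.trace_sum, ← Finset.sum_mul, hE.sum_eq_one, one_mul]
  have hnn (o : O) : 0 ≤ (E o * σ).trace.re := by
    obtain ⟨D, rfl⟩ := posSemidef_eq_conjTranspose_mul_self hσ
    rw [← Matrix.mul_assoc, Matrix.trace_mul_comm, ← Matrix.mul_assoc]
    exact (Complex.le_def.1 ((hE.posSemidef o).mul_mul_conjTranspose_same D).trace_nonneg).1
  calc ‖∑ o, (E o * σ.submatrix (e o) id).trace‖
      ≤ ∑ o, √(E o * σ).trace.re * √σ.trace.re :=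
        norm_sum_le_of_le _ fun o _ => norm_trace_mul_submatrix_le (hE.posSemidef o)
          (hE.one_sub_posSemidef o) hσ (e o)
    -- The factors `√1` set up Cauchy–Schwarz against the constant vector, the source of
    -- `√(Fintype.card O)`.
    _ = (∑ o, √1 * √(E o * σ).trace.re) * √σ.trace.re := by simp [Finset.sum_mul]
    _ ≤ (√(∑ _o : O, 1) * √(∑ o, (E o * σ).trace.re)) * √σ.trace.re := by
        gcongr
        exact Real.sum_sqrt_mul_sqrt_le _ (fun _ => zero_le_one) hnn
    _ = √(Fintype.card O) * σ.trace.re := by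
        rw [hsum, mul_assoc, Real.mul_self_sqrt hσ0]; simp

end TraceInequalities

/-! ### Entanglement fidelity as a sum of channel matrix entries. -/

section Fidelity

variable {n : Type*} [Fintype n] [DecidableEq n]

/-- Needed at `c = 1` for the root of the pure state, and at `c = ⟨v|ρ|v⟩` for the root inside the
trace norm. -/
theorem sqrt_smul_vecMulVec {v : n → ℂ} (hv : star v ⬝ᵥ v = 1) {c : ℝ} (hc : 0 ≤ c) :
    CFC.sqrt ((c : ℂ) • Matrix.vecMulVec v (star v)) =
      ((√c : ℝ) : ℂ) • Matrix.vecMulVec v (star v) := by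
  refine CFC.sqrt_unique ?_ ?_
  · rw [smul_mul_smul_comm, Matrix.vecMulVec_mul_vecMulVec, hv, one_smul, ← Complex.ofReal_mul,
      Real.mul_self_sqrt hc]
  · exact ((Matrix.posSemidef_vecMulVec_self_star v).smul
      (Complex.zero_le_real.2 (Real.sqrt_nonneg c))).nonneg

/-- The fidelity with a pure state is the overlap with that state. -/
theorem fidelity_vecMulVec_of_posSemidef {ρ : Matrix n n ℂ} (hρ : ρ.PosSemidef) {v : n → ℂ}
    (hv : star v ⬝ᵥ v = 1) :
    fidelity ρ (Matrix.vecMulVec v (star v)) = ‖star v ⬝ᵥ ρ *ᵥ v‖ := by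
  have hsv : CFC.sqrt (Matrix.vecMulVec v (star v)) = Matrix.vecMulVec v (star v) := by
    simpa using sqrt_smul_vecMulVec hv zero_le_one
  have htr : (Matrix.vecMulVec v (star v)).trace = 1 := by
    rw [Matrix.trace_vecMulVec, dotProduct_comm, hv]
  have h0 : 0 ≤ star v ⬝ᵥ ρ *ᵥ v := hρ.dotProduct_mulVec_nonneg v
  obtain ⟨c, hc, hcv⟩ : ∃ c : ℝ, 0 ≤ c ∧ star v ⬝ᵥ ρ *ᵥ v = c :=
    ⟨_, (Complex.le_def.1 h0).1, Complex.ext rfl (Complex.le_def.1 h0).2.symm⟩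
  have hsq : (CFC.sqrt ρ * Matrix.vecMulVec v (star v))ᴴ *
      (CFC.sqrt ρ * Matrix.vecMulVec v (star v)) = (c : ℂ) • Matrix.vecMulVec v (star v) := by
    have hsa : (CFC.sqrt ρ)ᴴ = CFC.sqrt ρ :=
      (Matrix.nonneg_iff_posSemidef.1 (CFC.sqrt_nonneg ρ)).isHermitian
    rw [Matrix.conjTranspose_mul, hsa, Matrix.mul_assoc, ← Matrix.mul_assoc (CFC.sqrt ρ),
      CFC.sqrt_mul_sqrt_self ρ hρ.nonneg,
      (Matrix.posSemidef_vecMulVec_self_star v).isHermitian.eq,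
      Matrix.mul_vecMulVec, Matrix.vecMulVec_mul_vecMulVec, hcv, Matrix.vecMulVec_smul]
  rw [fidelity, traceNorm, hsv, hsq, sqrt_smul_vecMulVec hv hc, Matrix.trace_smul, htr, hcv]
  simp [Real.sq_sqrt hc, abs_of_nonneg hc]

theorem star_maxEntangledVec_dotProduct_self {d : ℕ} (hd : 0 < d) :
    star (maxEntangledVec d) ⬝ᵥ maxEntangledVec d = 1 := by
  have h : ((√d : ℝ) : ℂ) * ((√d : ℝ) : ℂ) = d := by
    rw [← Complex.ofReal_mul, Real.mul_self_sqrt (Nat.cast_nonneg d), Complex.ofReal_natCast]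
  simp [dotProduct, maxEntangledVec, Fintype.sum_prod_type, ← mul_inv, h, hd.ne', apply_ite]

theorem maxEntangled_block {d : ℕ} (r r' : Fin d) :
    (Matrix.of fun i j => maxEntangled d (r, i) (r', j)) =
      (d : ℂ)⁻¹ • Matrix.single r r' (1 : ℂ) := by
  have h : ((√d : ℝ) : ℂ) * ((√d : ℝ) : ℂ) = d := by
    rw [← Complex.ofReal_mul, Real.mul_self_sqrt (Nat.cast_nonneg d), Complex.ofReal_natCast]
  ext i j
  by_cases h1 : r = i <;> by_cases h2 : r' = j <;>
    simp [maxEntangled, maxEntangledVec, Matrix.vecMulVec_apply, h1, h2, ← mul_inv, h]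

theorem overlap_maxEntangled_idTensor {d : ℕ}
    (Λ : Matrix (Fin d) (Fin d) ℂ →ₗ[ℂ] Matrix (Fin d) (Fin d) ℂ) :
    star (maxEntangledVec d) ⬝ᵥ idTensor (Fin d) Λ (maxEntangled d) *ᵥ maxEntangledVec d =
      ((d : ℂ) ^ 2)⁻¹ * ∑ r, ∑ r', Λ (Matrix.single r r' 1) r r' := by
  have h : ((√d : ℝ) : ℂ) * ((√d : ℝ) : ℂ) = d := by
    rw [← Complex.ofReal_mul, Real.mul_self_sqrt (Nat.cast_nonneg d), Complex.ofReal_natCast]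
  have hinv : ((√d : ℝ) : ℂ)⁻¹ * ((√d : ℝ) : ℂ)⁻¹ = (d : ℂ)⁻¹ := by rw [← mul_inv, h]
  have hstar : star (((√d : ℝ) : ℂ)⁻¹) = ((√d : ℝ) : ℂ)⁻¹ := by simp
  simp only [dotProduct, Matrix.mulVec, Fintype.sum_prod_type, idTensor, Matrix.of_apply,
    maxEntangled_block,
    maxEntangledVec, map_smul, Matrix.smul_apply, Pi.star_apply, apply_ite star, star_zero,
    ite_mul, mul_ite, zero_mul, mul_zero, Finset.sum_ite_eq, Finset.mem_univ, if_true,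
    Finset.mul_sum, hstar, smul_eq_mul]
  refine Finset.sum_congr rfl fun r _ => ?_
  rw [Finset.sum_eq_single r (by intro b _ hb; simp [hb.symm]) (by simp)]
  refine Finset.sum_congr rfl fun r' _ => ?_
  rw [if_pos rfl, sq, mul_inv, ← hinv]
  ring

end Fidelity

/-! ### From the channel to swap traces, and the final bound. -/

namespace Protocol

/-- The exchange of Alice's input register with the `i`-th port, on basis labels. -/
def swapPort (d : ℕ) {N : ℕ} (α : Type*) (i : Fin N) :
    Equiv.Perm ((Fin d × α) × Ports d N) where
  toFun z := ((z.2 i, z.1.2), Function.update z.2 i z.1.1)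
  invFun z := ((z.2 i, z.1.2), Function.update z.2 i z.1.1)
  left_inv z := by simp
  right_inv z := by simp

@[simp]
theorem swapPort_apply {d N : ℕ} {α : Type*} (i : Fin N)
    (z : (Fin d × α) × Ports d N) :
    swapPort d α i z = ((z.2 i, z.1.2), Function.update z.2 i z.1.1) := rfl

variable {d N : ℕ} {α : Type*} [Fintype α] [DecidableEq α]

/-- Alice's POVM element, acting trivially on Bob's ports. -/
def effect (P : Protocol d N α) (i : Fin N) :
    Matrix ((Fin d × α) × Ports d N) ((Fin d × α) × Ports d N) ℂ :=
  P.povm i ⊗ₖ (1 : Matrix (Ports d N) (Ports d N) ℂ)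

/-- The resource state next to the identity on Alice's input register. -/
def extendedResource (P : Protocol d N α) :
    Matrix ((Fin d × α) × Ports d N) ((Fin d × α) × Ports d N) ℂ :=
  ((1 : Matrix (Fin d) (Fin d) ℂ) ⊗ₖ P.resource).reindex
    (Equiv.prodAssoc _ _ _).symm (Equiv.prodAssoc _ _ _).symm

theorem isPOVM_effect (P : Protocol d N α) : IsPOVM P.effect where
  posSemidef i := (P.isPOVM.posSemidef i).kronecker Matrix.PosSemidef.one
  sum_eq_one := by
    have : ∑ i, P.effect i = (∑ i, P.povm i) ⊗ₖ (1 : Matrix (Ports d N) (Ports d N) ℂ) := by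
      ext x y
      simp [effect, Matrix.sum_apply, Finset.sum_mul, Matrix.kroneckerMap_apply]
    rw [this, P.isPOVM.sum_eq_one, Matrix.one_kronecker_one]

theorem posSemidef_extendedResource (P : Protocol d N α) : P.extendedResource.PosSemidef :=
  (Matrix.PosSemidef.one.kronecker P.isState.posSemidef).submatrix _

theorem trace_extendedResource (P : Protocol d N α) : P.extendedResource.trace = d := by
  have h : P.extendedResource.trace =
      ((1 : Matrix (Fin d) (Fin d) ℂ) ⊗ₖ P.resource).trace :=
    Equiv.sum_comp (Equiv.prodAssoc (Fin d) α (Ports d N))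
      fun j => ((1 : Matrix (Fin d) (Fin d) ℂ) ⊗ₖ P.resource) j j
  rw [h, Matrix.trace_kronecker, P.isState.trace_eq_one]
  simp

/-- The coordinate form behind both the positivity of the Choi matrix and the swap identity. -/
theorem selectPort_branch_single_apply (P : Protocol d N α) (i : Fin N) (r r' b b' : Fin d) :
    selectPort i (partialTraceLeft (P.branch i (Matrix.single r r' 1))) b b' =
      ∑ c : {j : Fin N // j ≠ i} → Fin d, ∑ a, ∑ a', P.povm i (r', a) (r, a') *
        P.resource (a', (Equiv.funSplitAt i (Fin d)).symm (b, c))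
          (a, (Equiv.funSplitAt i (Fin d)).symm (b', c)) := by
  simp only [selectPort, partialTraceLeft, branch, LinearMap.coe_mk, AddHom.coe_mk,
    Matrix.of_apply, Matrix.mul_apply, Fintype.sum_prod_type, Matrix.kroneckerMap_apply,
    Matrix.reindex_apply, Matrix.submatrix_apply, Equiv.symm_symm, Equiv.prodAssoc_apply,
    Matrix.one_apply, Matrix.single_apply, mul_ite, ite_mul, mul_one, one_mul, mul_zero,
    zero_mul, ite_and]
  refine Finset.sum_congr rfl fun c _ => ?_
  simp

/-- The Choi matrix of the channel is positive. -/
theorem posSemidef_idTensor_channel (P : Protocol d N α) :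
    (idTensor (Fin d) P.channel (maxEntangled d)).PosSemidef := by
  choose C hC using fun i => posSemidef_eq_conjTranspose_mul_self (P.isPOVM.posSemidef i)
  -- Kraus operators from the resource to reference and output: row `y` of the factor `C i` of `E_i`
  -- acts on Alice's side, and `c` is a basis state of the discarded ports.
  let K (i : Fin N) (c : {j : Fin N // j ≠ i} → Fin d) (y : Fin d × α) :
      Matrix (Fin d × Fin d) (α × Ports d N) ℂ :=
    Matrix.of fun p q =>
      if q.2 = (Equiv.funSplitAt i (Fin d)).symm (p.2, c) then C i y (p.1, q.1) else 0
  have hK : idTensor (Fin d) P.channel (maxEntangled d) =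
      (d : ℂ)⁻¹ • ∑ i, ∑ c, ∑ y, K i c y * P.resource * (K i c y)ᴴ := by
    ext p q
    rw [idTensor, Matrix.of_apply, maxEntangled_block, map_smul, Matrix.smul_apply,
      Matrix.smul_apply, channel]
    simp only [LinearMap.sum_apply, LinearMap.comp_apply, Matrix.sum_apply,
      selectPort_branch_single_apply]
    congr 1
    refine Finset.sum_congr rfl fun i _ => Finset.sum_congr rfl fun c _ => ?_
    have hy (y : Fin d × α) : (K i c y * P.resource * (K i c y)ᴴ) p q =
        ∑ a, ∑ a', star (C i y (q.1, a)) * C i y (p.1, a') *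
          P.resource (a', (Equiv.funSplitAt i (Fin d)).symm (p.2, c))
            (a, (Equiv.funSplitAt i (Fin d)).symm (q.2, c)) := by
      simp only [K, Matrix.mul_apply, Fintype.sum_prod_type, Matrix.conjTranspose_apply,
        Matrix.of_apply, apply_ite star, star_zero, ite_mul, mul_ite, zero_mul, mul_zero,
        Finset.sum_ite_eq', Finset.mem_univ, if_true, Finset.sum_mul]
      exact Finset.sum_congr rfl fun a _ => Finset.sum_congr rfl fun a' _ => by ring
    simp only [hy]
    rw [eq_comm, Finset.sum_comm]
    refine Finset.sum_congr rfl fun a _ => ?_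
    rw [Finset.sum_comm]
    refine Finset.sum_congr rfl fun a' _ => ?_
    rw [← Finset.sum_mul, hC i]
    simp only [Matrix.mul_apply, Matrix.conjTranspose_apply]
  rw [hK]
  refine Matrix.PosSemidef.smul ?_ (inv_nonneg.2 (Nat.cast_nonneg d))
  exact Matrix.posSemidef_sum _ fun i _ => Matrix.posSemidef_sum _ fun c _ =>
    Matrix.posSemidef_sum _ fun y _ => P.isState.posSemidef.mul_mul_conjTranspose_same _

/-- The row label `r` of the matrix unit is also the row label read off at port `i`, so summing over
`r` and `r'` exchanges input and port. -/
theorem sum_branch_eq_trace (P : Protocol d N α) (i : Fin N) :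
    ∑ r, ∑ r', selectPort i (partialTraceLeft (P.branch i (Matrix.single r r' 1))) r r' =
      (P.effect i * P.extendedResource.submatrix (swapPort d α i) id).trace := by
  have hsum (f : Ports d N → ℂ) : ∑ b, f b = ∑ r, ∑ c : {j : Fin N // j ≠ i} → Fin d,
      f ((Equiv.funSplitAt i (Fin d)).symm (r, c)) := by
    rw [← Equiv.sum_comp (Equiv.funSplitAt i (Fin d)).symm, Fintype.sum_prod_type]
  have hi (r : Fin d) (c : {j : Fin N // j ≠ i} → Fin d) :
      (Equiv.funSplitAt i (Fin d)).symm (r, c) i = r := by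
    simp [Equiv.funSplitAt, Equiv.piSplitAt]
  have hu (r s : Fin d) (c : {j : Fin N // j ≠ i} → Fin d) :
      Function.update ((Equiv.funSplitAt i (Fin d)).symm (r, c)) i s =
        (Equiv.funSplitAt i (Fin d)).symm (s, c) := by
    ext j
    by_cases hj : j = i
    · subst hj; simp [Equiv.funSplitAt, Equiv.piSplitAt]
    · simp [Equiv.funSplitAt, Equiv.piSplitAt, hj]
  have hR : (P.effect i * P.extendedResource.submatrix (swapPort d α i) id).trace =
      ∑ r', ∑ a, ∑ c : {j : Fin N // j ≠ i} → Fin d, ∑ r, ∑ a', P.povm i (r', a) (r, a') *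
        P.resource (a', (Equiv.funSplitAt i (Fin d)).symm (r, c))
          (a, (Equiv.funSplitAt i (Fin d)).symm (r', c)) := by
    simp only [Matrix.trace, Matrix.diag_apply, Matrix.mul_apply, Fintype.sum_prod_type, effect,
      extendedResource, swapPort_apply, Matrix.kroneckerMap_apply,
      Matrix.reindex_apply, Matrix.submatrix_apply, Equiv.symm_symm, Equiv.prodAssoc_apply,
      Matrix.one_apply, mul_ite, ite_mul, mul_one, one_mul, mul_zero, zero_mul, id]
    refine Finset.sum_congr rfl fun r' _ => Finset.sum_congr rfl fun a _ => ?_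
    -- One delta comes from the identity on the ports, the other from the identity on the swapped
    -- input; reordering lets the port sum collapse first.
    have hite (x y : Ports d N) (z : ℂ) :
        (if x i = r' then if y = x then z else 0 else 0) =
          if y = x then if y i = r' then z else 0 else 0 := by
      split_ifs <;> simp_all
    rw [hsum]
    simp only [hite, Finset.sum_ite_eq, Finset.mem_univ, if_true, hi, hu]
    rw [Finset.sum_eq_single r']
    · simp
    · intro b _ hb; simp [hb]
    · simp
  simp only [selectPort_branch_single_apply]
  rw [hR, Finset.sum_comm]
  refine Finset.sum_congr rfl fun r' _ => ?_
  rw [Finset.sum_comm]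
  simp_rw [Finset.sum_comm (s := (Finset.univ : Finset (Fin d)))
    (t := (Finset.univ : Finset α))]
  rw [Finset.sum_comm]

theorem sum_channel_eq_sum_trace (P : Protocol d N α) :
    ∑ r, ∑ r', P.channel (Matrix.single r r' 1) r r' =
      ∑ i, (P.effect i * P.extendedResource.submatrix (swapPort d α i) id).trace := by
  simp only [← sum_branch_eq_trace, channel, LinearMap.sum_apply, Matrix.sum_apply,
    LinearMap.comp_apply]
  rw [Finset.sum_comm (s := (Finset.univ : Finset (Fin N)))]
  exact Finset.sum_congr rfl fun r _ => Finset.sum_comm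

theorem entanglementFidelity_le (hd : 0 < d) (P : Protocol d N α) :
    P.entanglementFidelity ≤ √N / d := by
  have hd' : (0 : ℝ) < d := Nat.cast_pos.2 hd
  have hid : idTensor (Fin d) LinearMap.id (maxEntangled d) =
      Matrix.vecMulVec (maxEntangledVec d) (star (maxEntangledVec d)) := rfl
  have hbound := P.isPOVM_effect.norm_sum_trace_mul_submatrix_le P.posSemidef_extendedResource
    (swapPort d α)
  rw [trace_extendedResource, Fintype.card_fin, Complex.natCast_re] at hbound
  calc P.entanglementFidelity
      ≤ ‖((d : ℂ) ^ 2)⁻¹ * ∑ r, ∑ r', P.channel (Matrix.single r r' 1) r r'‖ := by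
        rw [entanglementFidelity, channelFidelity, hid, ← overlap_maxEntangled_idTensor]
        exact (fidelity_vecMulVec_of_posSemidef P.posSemidef_idTensor_channel
          (star_maxEntangledVec_dotProduct_self hd)).le
    _ ≤ ((d : ℝ) ^ 2)⁻¹ * (√N * d) := by
        rw [sum_channel_eq_sum_trace, norm_mul, norm_inv, norm_pow, Complex.norm_natCast]
        gcongr
    _ = √N / d := by field_simp

end Protocol

end PBT

theorem mainTheorem11 (d N : ℕ) (hd : 0 < d) :
    (∀ (α : Type*) [Fintype α] [DecidableEq α] (P : PBT.Protocol d N α),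
      P.entanglementFidelity ≤ Real.sqrt N / d) ∧
    PBT.optimalFidelity d N ≤ Real.sqrt N / d :=
  ⟨fun _ _ _ P => P.entanglementFidelity_le hd,
    -- Nonnegativity of the bound covers an empty family of protocols (`N = 0`), where the real
    -- supremum is `0`.
    Real.iSup_le (fun p => p.2.entanglementFidelity_le hd) (by positivity)⟩
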